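/- Let $m,n\ge 1$. A producer sells $n$ divisible goods to $m$ consumers. The consumption set $\mathcal C\subset\mathbb R_+^n$ is convex and compact with non-empty interior and $\ell_2$-diameter $D=\max_{x,y\in\mathcal C}\|x-y\|_2>0$, and $\|x\|_2\le D$ for every $x\in\mathcal C$ (for instance because $0\in\mathcal C$). The valuations $v_1,\dots,v_m:\mathcal C\to\mathbb R_+$ are continuous and $\alpha$-strongly concave for some $\alpha>0$, i.e. $v_i(x)+\frac{\alpha}{2}\|x\|_2^2$ is concave. The cost $c:m\mathcal C\to\mathbb R_+$ is convex, non-decreasing in the coordinatewise order, and $\lambda$-Lipschitz in the $\ell_2$-norm for some $\lambda>0$. At prices $p\in\mathbb R_+^n$ consumer $i$ demands the (unique) bundle $x_i(p)\in\arg\max_{x\in\mathcal C}\big(v_i(x)-\langle x,p\rangle\big)$, and the aggregate demand oracle returns $\sum_{i=1}^m x_i(p)$. Let $$\mathrm{SW}(x_1,\dots,x_m)=\sum_{i=1}^m v_i(x_i)-c\Big(\sum_{i=1}^m x_i\Big),\qquad \mathrm{SW}^*=\max_{x_1,\dots,x_m\in\mathcal C}\mathrm{SW}(x_1,\dots,x_m).$$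 Given $T\ge 1$, put $\mu=\frac{2\lambda}{mD\sqrt T}$, $c_\mu(y)=c(y)+\frac{\mu}{2}\|y\|_2^2$, $\mathcal P=\{p\ge 0:\|p\|_2\le\lambda\}$, $L=\frac1\mu+\frac m\alpha$, and $$f_\mu(p)=c_\mu^*(p)-\sum_{i=1}^m v_i^*(p),\quad c_\mu^*(p)=\max_{y\in m\mathcal C}\big(\langle p,y\rangle-c_\mu(y)\big),\quad v_i^*(p)=\min_{x\in\mathcal C}\big(\langle p,x\rangle-v_i(x)\big).$$ The algorithm, which knows $m,\alpha,\lambda,\mathcal C,c,T$ but not the valuations, runs the accelerated gradient method AGM on $f_\mu$ over $\mathcal P$: starting from $y_0=z_0=0$, for $k=0,\dots,T-1$ it sets $\tau_k=\frac{2}{k+2}$, $a_{k+1}=\frac{k+2}{2L}$, $q_{k+1}=\tau_k z_k+(1-\tau_k)y_k$, queries the aggregate demand oracle at the prices $q_{k+1}$, computes $$g_{k+1}=\arg\max_{y\in m\mathcal C}\big(\langle y,q_{k+1}\rangle-c_\mu(y)\big)-\sum_{i=1}^m x_i(q_{k+1}),$$ and updates $$y_{k+1}=\arg\min_{u\in\mathcal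 P}\Big(\tfrac L2\|u-q_{k+1}\|_2^2+\langle g_{k+1},u-q_{k+1}\rangle\Big),\qquad z_{k+1}=\arg\min_{u\in\mathcal P}\Big(\tfrac12\|u-z_k\|_2^2+a_{k+1}\langle g_{k+1},u-z_k\rangle\Big).$$ It outputs the prices $p_\mu^T=y_T$. Then $\mathrm{SW}^*$ is attained, and for every $T\ge1$: the algorithm makes exactly $T$ queries to the aggregate demand oracle; all queried prices and the output $p_\mu^T$ lie in $\mathcal P$; for every $p\in\mathcal P$ the excess supply $\arg\max_{y\in m\mathcal C}(\langle y,p\rangle-c_\mu(y))-\sum_i x_i(p)$ is the gradient of $f_\mu$ at $p$ (so that $g_{k+1}=\nabla f_\mu(q_{k+1})$); and $$\Big|\mathrm{SW}^*-\mathrm{SW}\big(x_1(p_\mu^T),\dots,x_m(p_\mu^T)\big)\Big|\le\frac{9\lambda mD}{\sqrt T}+\frac{16\lambda^2m}{\alpha T}.$$ Consequently, there is a constant $K>0$ depending only on $\alpha,\lambda,D$ such that for every $\varepsilon>0$ and every $T\ge1$ with $T\ge Km^2/\varepsilon^2$ the left-hand side is at most $\varepsilon$; that is, $O(m^2/\varepsilon^2)$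 queries suffice for error $\varepsilon$. -/

import Mathlib

open scoped Pointwise

noncomputable section

/-- The space of bundles and of price vectors, `ℝⁿ` with the `ℓ₂` norm. -/
abbrev Bundle (n : ℕ) : Type := EuclideanSpace ℝ (Fin n)

/-! ### Algorithms with oracle access -/

/-- A deterministic adaptive algorithm that asks queries in `Q`, gets answers in `A`, and finally
outputs an element of `R`. It can depend on the oracle only through the answers received. -/
inductive OracleAlg (Q A R : Type) : Type where
  | output (r : R) : OracleAlg Q A R
  | query (q : Q) (next : A → OracleAlg Q A R) : OracleAlg Q A R

namespace OracleAlg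

variable {Q A B R : Type}

/-- The output of the algorithm when its queries are answered by the oracle `o`. -/
def run (o : Q → A) : OracleAlg Q A R → R
  | output r => r
  | query q next => (next (o q)).run o

/-- The queries that the algorithm makes, in order, when they are answered by the oracle `o`. -/
def queries (o : Q → A) : OracleAlg Q A R → List Q
  | output _ => []
  | query q next => q :: (next (o q)).queries o

/-- Run the algorithm with another oracle: the answer to the query `q` is computed from `q` and
from the answer `b` of the new oracle to `q`, as `h q b`. -/
def mapAnswers (h : Q → B → A) : OracleAlg Q A R → OracleAlg Q B R
  | output r => output r
  | query q next => query q fun b => (next (h q b)).mapAnswers h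

end OracleAlg

/-! ### Minimizers and conjugates -/

/-- A minimizer of `f` over `S` (an arbitrary point if there is none). -/
def argminOn {n : ℕ} (f : Bundle n → ℝ) (S : Set (Bundle n)) : Bundle n :=
  Classical.epsilon fun x => x ∈ S ∧ IsMinOn f S x

/-- Convex conjugate of `f : S → ℝ`: `f*(p) = sup_{x ∈ S} (⟨p, x⟩ - f x)`. -/
def convexConj {n : ℕ} (S : Set (Bundle n)) (f : Bundle n → ℝ) (p : Bundle n) : ℝ :=
  sSup ((fun x => inner ℝ p x - f x) '' S)

/-- Concave conjugate of `f : S → ℝ`: `f*(p) = inf_{x ∈ S} (⟨p, x⟩ - f x)`. -/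
def concaveConj {n : ℕ} (S : Set (Bundle n)) (f : Bundle n → ℝ) (p : Bundle n) : ℝ :=
  sInf ((fun x => inner ℝ p x - f x) '' S)

/-! ### The AGM method (accelerated gradient method by linear coupling, Euclidean norm) -/

/-- The last `t` iterations of AGM on the feasible set `P` with smoothness parameter `L`, started
at iteration number `k` in the state `(y, z) = (y_k, z_k)`. One iteration is
* `x_{k+1} = τ_k z_k + (1 - τ_k) y_k` with `τ_k = 2 / (k + 2)`;
* query the gradient `g` of the objective at `x_{k+1}`;
* gradient step: `y_{k+1}` minimizes `(L / 2) ‖u - x_{k+1}‖² + ⟨g, u - x_{k+1}⟩` over `u ∈ P`;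
* mirror step: `z_{k+1}` minimizes `(1 / 2) ‖u - z_k‖² + ⟨a_{k+1} g, u - z_k⟩` over `u ∈ P`,
  with `a_{k+1} = (k + 2) / (2 L)`. -/
def agmFrom {n : ℕ} (P : Set (Bundle n)) (L : ℝ) :
    (t k : ℕ) → (y z : Bundle n) → OracleAlg (Bundle n) (Bundle n) (Bundle n)
  | 0, _, y, _ => .output y
  | t + 1, k, y, z =>
    let τ : ℝ := 2 / ((k : ℝ) + 2)
    let a : ℝ := ((k : ℝ) + 2) / (2 * L)
    let x : Bundle n := τ • z + (1 - τ) • y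
    .query x fun g =>
      agmFrom P L t (k + 1)
        (argminOn (fun u => L / 2 * ‖u - x‖ ^ 2 + inner ℝ g (u - x)) P)
        (argminOn (fun u => 1 / 2 * ‖u - z‖ ^ 2 + inner ℝ (a • g) (u - z)) P)

/-- AGM with `T` iterations from the initial point `x₀`; its oracle is a gradient oracle. -/
def agm {n : ℕ} (P : Set (Bundle n)) (L : ℝ) (T : ℕ) (x₀ : Bundle n) :
    OracleAlg (Bundle n) (Bundle n) (Bundle n) :=
  agmFrom P L T 0 x₀ x₀

/-! ### The market -/

/-- Social welfare of the bundles `z 1, …, z m`. -/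
def socialWelfare {n m : ℕ} (v : Fin m → Bundle n → ℝ) (c : Bundle n → ℝ)
    (z : Fin m → Bundle n) : ℝ :=
  ∑ i, v i (z i) - c (∑ i, z i)

/-- `x` is a bundle demanded at prices `p`: it maximizes the quasilinear utility over `C`. -/
def IsDemand {n : ℕ} (C : Set (Bundle n)) (v : Bundle n → ℝ) (p x : Bundle n) : Prop :=
  x ∈ C ∧ IsMaxOn (fun z => v z - inner ℝ z p) C x

/-- The hypotheses of the offline market model with consumption set `C`, valuations `v i` on `C`
and cost `c` on `m C`. -/
structure IsOfflineMarket {n m : ℕ} (α lam : ℝ) (C : Set (Bundle n))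
    (v : Fin m → Bundle n → ℝ) (c : Bundle n → ℝ) : Prop where
  nonneg_of_mem : ∀ x ∈ C, ∀ j, 0 ≤ x j
  convex : Convex ℝ C
  isCompact : IsCompact C
  interior_nonempty : (interior C).Nonempty
  norm_le_diam : ∀ x ∈ C, ‖x‖ ≤ Metric.diam C
  val_nonneg : ∀ i, ∀ x ∈ C, 0 ≤ v i x
  val_continuousOn : ∀ i, ContinuousOn (v i) C
  val_strongConcaveOn : ∀ i, StrongConcaveOn C α (v i)
  cost_nonneg : ∀ y ∈ (m : ℝ) • C, 0 ≤ c y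
  cost_convexOn : ConvexOn ℝ ((m : ℝ) • C) c
  cost_mono : ∀ y ∈ (m : ℝ) • C, ∀ z ∈ (m : ℝ) • C, (∀ j, y j ≤ z j) → c y ≤ c z
  cost_lipschitzOnWith : LipschitzOnWith lam.toNNReal c ((m : ℝ) • C)

/-! ### The algorithm -/

/-- The feasible set of the dual problem: prices `p ≥ 0` with `‖p‖₂ ≤ lam`. -/
def priceSet (n : ℕ) (lam : ℝ) : Set (Bundle n) :=
  {p | (∀ j, 0 ≤ p j) ∧ ‖p‖ ≤ lam}

/-- The smoothing parameter `μ = 2 lam / (m D √T)`, where `D` is the diameter of `C`. -/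
def smoothingParam {n : ℕ} (m : ℕ) (lam : ℝ) (C : Set (Bundle n)) (T : ℕ) : ℝ :=
  2 * lam / (m * Metric.diam C * √(T : ℝ))

/-- The smoothed cost `c_μ(y) = c(y) + (μ / 2) ‖y‖²`. -/
def smoothedCost {n : ℕ} (μ : ℝ) (c : Bundle n → ℝ) (y : Bundle n) : ℝ :=
  c y + μ / 2 * ‖y‖ ^ 2

/-- The dual objective `c* - ∑ i, (v i)*`. -/
def dualObjective {n m : ℕ} (C : Set (Bundle n)) (v : Fin m → Bundle n → ℝ)
    (c : Bundle n → ℝ) (p : Bundle n) : ℝ :=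
  convexConj ((m : ℝ) • C) c p - ∑ i, concaveConj C (v i) p

/-- The producer's supply at prices `p` for the cost `c`: a maximizer of `⟨y, p⟩ - c y` over
`y ∈ m C`, that is, a subgradient of `c*` at `p`. -/
def supply {n : ℕ} (m : ℕ) (C : Set (Bundle n)) (c : Bundle n → ℝ) (p : Bundle n) : Bundle n :=
  argminOn (fun y => c y - inner ℝ y p) ((m : ℝ) • C)

/-- Offline social welfare maximization: AGM with `T` iterations on `priceSet n lam`, started at
`0`, with smoothness parameter `1 / μ + m / α`. A gradient query at prices `p` is answered by the
excess supply: the supply for the smoothed cost minus the answer `d` of the aggregate demand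
oracle at `p`. The algorithm knows `m, α, lam, C, c, T`, but not the valuations. -/
def offlineSWAlg {n : ℕ} (m : ℕ) (α lam : ℝ) (C : Set (Bundle n)) (c : Bundle n → ℝ) (T : ℕ) :
    OracleAlg (Bundle n) (Bundle n) (Bundle n) :=
  (agm (priceSet n lam) (1 / smoothingParam m lam C T + m / α) T 0).mapAnswers
    fun p d => supply m C (smoothedCost (smoothingParam m lam C T) c) p - d

end

/-!
The smoothed dual objective `f` is the conjugate of the smoothed cost plus the consumers' indirect
utilities. Each summand is the conjugate of a strongly convex function, so quadratic growth around
the maximizing bundle (`StrongConvexOn.add_sq_norm_sub_le_of_isMinOn`) gives, with `g` the excess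
supply and `L = 1 / μ + m / α`,
`f q + ⟪g q, u - q⟫ ≤ f u ≤ f q + ⟪g q, u - q⟫ + L / 2 * ‖u - q‖ ^ 2`.
These two inequalities make `g` the gradient of `f`, and they are all that the analysis of AGM uses:
linear coupling (`agm_step`) decreases the potential
`k (k + 2) / (4 L) * (f y_k - min f) + ‖u - z_k‖ ^ 2 / 2`, whence `f y_T - min f = O(L lam² / T²)`.

Welfare is controlled through stationarity of the final prices rather than through strong duality.
By smoothness along a step of length `1 / T`, the Frank-Wolfe gap `⟪g p, p - u⟫` at `p = y_T` is at
most `4 L lam² / T` for every feasible price vector `u` (`agm_gap_le`). On the other hand, the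
optimality of demand and of supply at `p` shows that the welfare loss of the demanded bundles is at
most the smoothing bias `μ / 2 * (m D) ^ 2` plus `c X - c y - ⟪p, X - y⟫`, where `X` is the aggregate
demand and `y` the supply. As `c` is nondecreasing and `lam`-Lipschitz on a convex set with interior,
it has at `X` an approximate subgradient `u` that is itself a feasible price vector
(`ConvexOn.exists_approx_subgradient_mem_priceSet`), and the last expression is then, up to an
arbitrarily small error, at most `⟪u - p, X - y⟫ = ⟪g p, p - u⟫`
(`IsOfflineMarket.socialWelfare_sub_le`). The choice of `μ` balances the bias against the gap.
-/

/-! ### Minimizers of strongly convex functions -/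

/-- Quadratic growth of a strongly convex function away from its minimizer. -/
theorem StrongConvexOn.add_sq_norm_sub_le_of_isMinOn {n : ℕ} {S : Set (Bundle n)} {σ : ℝ}
    {h : Bundle n → ℝ} (hh : StrongConvexOn S σ h) {x u : Bundle n} (hx : x ∈ S)
    (hmin : IsMinOn h S x) (hu : u ∈ S) : h x + σ / 2 * ‖u - x‖ ^ 2 ≤ h u := by
  -- compare `h x` with `h (a x + (1 - a) u)`, divide by `1 - a`, and let `a` tend to `1`
  have key : ∀ a ∈ Set.Ioo (0 : ℝ) 1, h x + a * (σ / 2 * ‖u - x‖ ^ 2) ≤ h u := by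
    rintro a ⟨ha, ha1⟩
    have hb : 0 < 1 - a := by linarith
    have hmem := hh.1 hx hu ha.le hb.le (by ring)
    have h1 := hh.2 hx hu ha.le hb.le (by ring)
    have h2 : h x ≤ h (a • x + (1 - a) • u) := hmin hmem
    rw [norm_sub_rev x u] at h1
    simp only [smul_eq_mul] at h1
    have h3 : (1 - a) * (h x + a * (σ / 2 * ‖u - x‖ ^ 2)) ≤ (1 - a) * h u := by linarith
    exact le_of_mul_le_mul_left h3 hb
  have hlim : Filter.Tendsto (fun a : ℝ => h x + a * (σ / 2 * ‖u - x‖ ^ 2))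
      (nhdsWithin 1 (Set.Iio 1)) (nhds (h x + 1 * (σ / 2 * ‖u - x‖ ^ 2))) :=
    Filter.Tendsto.mono_left (Continuous.tendsto (by fun_prop) 1) nhdsWithin_le_nhds
  rw [one_mul] at hlim
  refine le_of_tendsto hlim ?_
  filter_upwards [Ioo_mem_nhdsLT (zero_lt_one' ℝ)] with a ha using key a ha

theorem StrongConvexOn.sub_inner {n : ℕ} {S : Set (Bundle n)} {σ : ℝ}
    {h : Bundle n → ℝ} (hh : StrongConvexOn S σ h) (q : Bundle n) :
    StrongConvexOn S σ fun y => h y - inner ℝ q y := by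
  refine ⟨hh.1, fun x hx y hy a b ha hb hab => ?_⟩
  have := hh.2 hx hy ha hb hab
  simp only [smul_eq_mul, inner_add_right, inner_smul_right] at this ⊢
  linarith

theorem argminOn_spec {n : ℕ} {f : Bundle n → ℝ} {S : Set (Bundle n)} (hS : IsCompact S)
    (hne : S.Nonempty) (hf : ContinuousOn f S) : argminOn f S ∈ S ∧ IsMinOn f S (argminOn f S) := by
  have h : ∃ x, x ∈ S ∧ IsMinOn f S x := hS.exists_isMinOn hne hf
  exact Classical.epsilon_spec h

theorem strongConvexOn_half_sq_norm_sub_add_inner {n : ℕ} {P : Set (Bundle n)} (hP : Convex ℝ P)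
    (z g : Bundle n) :
    StrongConvexOn P 1 fun u => 1 / 2 * ‖u - z‖ ^ 2 + inner ℝ g (u - z) := by
  refine strongConvexOn_iff_convex.2 ⟨hP, fun x _ y _ a b _ _ hab => le_of_eq ?_⟩
  obtain rfl : b = 1 - a := by linarith
  simp only [norm_sub_sq_real, inner_sub_right, inner_add_right, inner_add_left, inner_smul_left,
    inner_smul_right, smul_eq_mul, RCLike.conj_to_real]
  ring

/-- The three-point inequality for a proximal step over a convex set. -/
theorem half_sq_norm_sub_three_point {n : ℕ} {P : Set (Bundle n)} (hP : Convex ℝ P)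
    {z g w u : Bundle n} (hw : w ∈ P)
    (hmin : IsMinOn (fun u => 1 / 2 * ‖u - z‖ ^ 2 + inner ℝ g (u - z)) P w) (hu : u ∈ P) :
    1 / 2 * ‖w - z‖ ^ 2 + inner ℝ g (w - z) + 1 / 2 * ‖u - w‖ ^ 2
      ≤ 1 / 2 * ‖u - z‖ ^ 2 + inner ℝ g (u - z) := by
  simpa using
    (strongConvexOn_half_sq_norm_sub_add_inner hP z g).add_sq_norm_sub_le_of_isMinOn hw hmin hu

/-! ### Conjugates -/

theorem convexConj_eq_of_isMinOn {n : ℕ} {S : Set (Bundle n)} {f : Bundle n → ℝ}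
    {p x : Bundle n} (hx : x ∈ S) (hmin : IsMinOn (fun y => f y - inner ℝ p y) S x) :
    convexConj S f p = inner ℝ p x - f x := by
  refine IsGreatest.csSup_eq ⟨⟨x, hx, rfl⟩, ?_⟩
  rintro _ ⟨y, hy, rfl⟩
  have : f x - inner ℝ p x ≤ f y - inner ℝ p y := hmin hy
  dsimp only
  linarith

theorem le_convexConj {n : ℕ} {S : Set (Bundle n)} {f : Bundle n → ℝ} (hS : IsCompact S)
    (hf : ContinuousOn f S) (p : Bundle n) {y : Bundle n} (hy : y ∈ S) :
    inner ℝ p y - f y ≤ convexConj S f p :=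
  le_csSup (hS.bddAbove_image (ContinuousOn.sub (by fun_prop) hf)) ⟨y, hy, rfl⟩

theorem concaveConj_eq_neg_convexConj {n : ℕ} (S : Set (Bundle n)) (f : Bundle n → ℝ)
    (p : Bundle n) : concaveConj S f p = -convexConj S (-f) (-p) := by
  rw [concaveConj, convexConj, Real.sInf_def, ← Set.image_neg_eq_neg, Set.image_image]
  simp only [inner_neg_left, Pi.neg_apply, sub_neg_eq_add, neg_sub]
  congr 3
  ext x
  ring

/-- A maximizer in the definition of the conjugate at `q` is a subgradient of the conjugate there. -/
theorem convexConj_add_inner_le {n : ℕ} {S : Set (Bundle n)} {f : Bundle n → ℝ}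
    (hS : IsCompact S) (hf : ContinuousOn f S) {q x : Bundle n} (hx : x ∈ S)
    (hmin : IsMinOn (fun y => f y - inner ℝ q y) S x) (u : Bundle n) :
    convexConj S f q + inner ℝ x (u - q) ≤ convexConj S f u := by
  rw [convexConj_eq_of_isMinOn hx hmin]
  have := le_convexConj hS hf u hx
  rw [inner_sub_right, real_inner_comm u x, real_inner_comm q x]
  linarith

/-- The conjugate of a `σ`-strongly convex function is `1 / σ`-smooth. -/
theorem convexConj_le_add_inner_add {n : ℕ} {S : Set (Bundle n)} {f : Bundle n → ℝ} {σ : ℝ}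
    (hσ : 0 < σ) (hfc : StrongConvexOn S σ f) {q x : Bundle n} (hx : x ∈ S)
    (hmin : IsMinOn (fun y => f y - inner ℝ q y) S x) (u : Bundle n) :
    convexConj S f u ≤ convexConj S f q + inner ℝ x (u - q) + 1 / σ / 2 * ‖u - q‖ ^ 2 := by
  rw [convexConj_eq_of_isMinOn hx hmin]
  refine csSup_le (Set.Nonempty.image _ ⟨x, hx⟩) ?_
  rintro _ ⟨y, hy, rfl⟩
  have h1 := (hfc.sub_inner q).add_sq_norm_sub_le_of_isMinOn hx hmin hy
  have h2 : inner ℝ (y - x) (u - q) ≤ ‖y - x‖ * ‖u - q‖ := real_inner_le_norm _ _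
  -- Young's inequality with weight `σ`
  have h3 : ‖y - x‖ * ‖u - q‖ ≤ σ / 2 * ‖y - x‖ ^ 2 + 1 / σ / 2 * ‖u - q‖ ^ 2 := by
    have : σ / 2 * ‖y - x‖ ^ 2 + 1 / σ / 2 * ‖u - q‖ ^ 2 - ‖y - x‖ * ‖u - q‖
        = 1 / (2 * σ) * (σ * ‖y - x‖ - ‖u - q‖) ^ 2 := by field_simp; ring
    have : 0 ≤ 1 / (2 * σ) * (σ * ‖y - x‖ - ‖u - q‖) ^ 2 := by positivity
    linarith
  simp only [inner_sub_left, inner_sub_right] at h2 ⊢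
  simp only [real_inner_comm y, real_inner_comm x] at h1 h2 ⊢
  simp only [real_inner_comm u, real_inner_comm q] at h1 h2 ⊢
  linarith

/-- Two-sided quadratic bounds on the increments of a function make their linear part its
gradient. -/
theorem hasGradientAt_of_quadratic_bounds {n : ℕ} {f : Bundle n → ℝ} {p g : Bundle n} {L : ℝ}
    (hlow : ∀ u, f p + inner ℝ g (u - p) ≤ f u)
    (hup : ∀ u, f u ≤ f p + inner ℝ g (u - p) + L / 2 * ‖u - p‖ ^ 2) : HasGradientAt f g p := by
  rw [hasGradientAt_iff_isLittleO]
  have hO : (fun u => f u - f p - inner ℝ g (u - p)) =O[nhds p] fun u => ‖u - p‖ ^ 2 := by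
    refine Asymptotics.IsBigO.of_bound (L / 2) (Filter.Eventually.of_forall fun u => ?_)
    rw [Real.norm_of_nonneg (by linarith [hlow u]), Real.norm_of_nonneg (by positivity)]
    linarith [hup u]
  refine hO.trans_isLittleO ?_
  exact Asymptotics.isLittleO_pow_sub_sub p one_lt_two

/-! ### Algorithms with oracle access -/

namespace OracleAlg

variable {Q A B R : Type}

theorem run_mapAnswers (h : Q → B → A) (o : Q → B) (M : OracleAlg Q A R) :
    (M.mapAnswers h).run o = M.run fun q => h q (o q) := by
  induction M with
  | output r => rfl
  | query q next ih => exact ih _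

theorem queries_mapAnswers (h : Q → B → A) (o : Q → B) (M : OracleAlg Q A R) :
    (M.mapAnswers h).queries o = M.queries fun q => h q (o q) := by
  induction M with
  | output r => rfl
  | query q next ih => exact congrArg (List.cons q) (ih _)

end OracleAlg

/-! ### Convergence of the accelerated gradient method -/

section AGM

variable {n : ℕ} {P : Set (Bundle n)}

theorem gradStep_spec (hPc : IsCompact P) (hne : P.Nonempty) (L : ℝ) (x g : Bundle n) :
    argminOn (fun u => L / 2 * ‖u - x‖ ^ 2 + inner ℝ g (u - x)) P ∈ P ∧
      IsMinOn (fun u => L / 2 * ‖u - x‖ ^ 2 + inner ℝ g (u - x)) P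
        (argminOn (fun u => L / 2 * ‖u - x‖ ^ 2 + inner ℝ g (u - x)) P) :=
  argminOn_spec hPc hne (by fun_prop)

theorem agm_couple_mem (hP : Convex ℝ P) (k : ℕ) {y z : Bundle n} (hy : y ∈ P) (hz : z ∈ P) :
    (2 / ((k : ℝ) + 2)) • z + (1 - 2 / ((k : ℝ) + 2)) • y ∈ P := by
  have h1 : 2 / ((k : ℝ) + 2) ≤ 1 := by
    rw [div_le_one (by positivity)]
    linarith [(Nat.cast_nonneg k : (0 : ℝ) ≤ k)]
  exact hP hz hy (by positivity) (by linarith) (by ring)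

theorem agmFrom_feasible (hP : Convex ℝ P) (hPc : IsCompact P) (L : ℝ) (o : Bundle n → Bundle n)
    (t k : ℕ) {y z : Bundle n} (hy : y ∈ P) (hz : z ∈ P) :
    ((agmFrom P L t k y z).queries o).length = t ∧
      (∀ q ∈ (agmFrom P L t k y z).queries o, q ∈ P) ∧ (agmFrom P L t k y z).run o ∈ P := by
  induction t generalizing k y z with
  | zero => simpa [agmFrom, OracleAlg.queries, OracleAlg.run] using hy
  | succ t ih =>
    have hx := agm_couple_mem hP k hy hz
    obtain ⟨h1, h2, h3⟩ := ih (k + 1)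
      (gradStep_spec hPc ⟨y, hy⟩ L _ (o ((2 / ((k : ℝ) + 2)) • z + (1 - 2 / ((k : ℝ) + 2)) • y))).1
      (gradStep_spec hPc ⟨y, hy⟩ 1 z ((((k : ℝ) + 2) / (2 * L)) •
        o ((2 / ((k : ℝ) + 2)) • z + (1 - 2 / ((k : ℝ) + 2)) • y))).1
    refine ⟨?_, ?_, h3⟩
    · simpa [agmFrom, OracleAlg.queries] using h1
    · intro q hq
      rcases List.mem_cons.1 hq with rfl | hq
      · exact hx
      · exact h2 q hq

/-- One iteration of linear coupling, in potential form: the gradient step pays for the regret of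
the mirror step. -/
theorem agm_step (hP : Convex ℝ P) {L : ℝ} (hL : 0 < L) {f : Bundle n → ℝ}
    {g : Bundle n → Bundle n}
    (hlow : ∀ q ∈ P, ∀ u ∈ P, f q + inner ℝ (g q) (u - q) ≤ f u)
    (hup : ∀ q ∈ P, ∀ u ∈ P, f u ≤ f q + inner ℝ (g q) (u - q) + L / 2 * ‖u - q‖ ^ 2)
    (k : ℕ) {x y z y' z' u : Bundle n} (hy : y ∈ P) (hz : z ∈ P) (hu : u ∈ P)
    (hx : x = (2 / ((k : ℝ) + 2)) • z + (1 - 2 / ((k : ℝ) + 2)) • y)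
    (hy' : y' ∈ P)
    (hymin : IsMinOn (fun u => L / 2 * ‖u - x‖ ^ 2 + inner ℝ (g x) (u - x)) P y')
    (hz' : z' ∈ P)
    (hzmin : IsMinOn (fun u => 1 / 2 * ‖u - z‖ ^ 2
      + inner ℝ ((((k : ℝ) + 2) / (2 * L)) • g x) (u - z)) P z') :
    ((k : ℝ) + 2) ^ 2 / (4 * L) * (f y' - f u) + 1 / 2 * ‖u - z'‖ ^ 2
      ≤ (k : ℝ) * (k + 2) / (4 * L) * (f y - f u) + 1 / 2 * ‖u - z‖ ^ 2 := by
  have hk : (0 : ℝ) ≤ k := Nat.cast_nonneg k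
  have hxP : x ∈ P := hx ▸ agm_couple_mem hP k hy hz
  set s : ℝ := (k : ℝ) + 2 with hs
  have hs0 : 0 < s := by positivity
  -- mirror step
  have h1 := half_sq_norm_sub_three_point hP hz' hzmin hu
  -- gradient step, compared with the point `w` obtained from `x` on replacing `z` by `z'`
  have hw := agm_couple_mem hP k hy hz'
  set w := (2 / s) • z' + (1 - 2 / s) • y with hwdef
  have hwx : w - x = (2 / s) • (z' - z) := by rw [hwdef, hx]; module
  have h2 : L / 2 * ‖y' - x‖ ^ 2 + inner ℝ (g x) (y' - x)
      ≤ L / 2 * ‖w - x‖ ^ 2 + inner ℝ (g x) (w - x) := hymin hw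
  rw [hwx, norm_smul, inner_smul_right, Real.norm_of_nonneg (by positivity), mul_pow] at h2
  have h3 := hup x hxP y' hy'
  have h4 := hlow x hxP y hy
  have h5 := hlow x hxP u hu
  -- the coupling: `x - z` is a multiple of `y - x`
  have hxz : x - z = ((s - 2) / 2) • (y - x) := by
    have : z = (s / 2) • x - ((s - 2) / 2) • y := by
      rw [hx]
      match_scalars <;> field_simp
      ring
    rw [this]
    match_scalars <;> ring
  have h6 : inner ℝ (g x) (x - z) = (s - 2) / 2 * inner ℝ (g x) (y - x) := by
    rw [hxz, inner_smul_right]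
  have h7 : inner ℝ (g x) (u - z) = inner ℝ (g x) (u - x) + inner ℝ (g x) (x - z) := by
    rw [← inner_add_right]; congr 1; abel
  rw [inner_smul_left, inner_smul_left, RCLike.conj_to_real, h7, h6] at h1
  have h8 : 1 / 2 * ‖z' - z‖ ^ 2 + s / (2 * L) * inner ℝ (g x) (z' - z)
      = s ^ 2 / (4 * L) * (L / 2 * ((2 / s) ^ 2 * ‖z' - z‖ ^ 2)
        + 2 / s * inner ℝ (g x) (z' - z)) := by
    field_simp
    ring
  have h9 : s ^ 2 / (4 * L) * (f y' - f x) ≤ s ^ 2 / (4 * L) * (L / 2 * ((2 / s) ^ 2 * ‖z' - z‖ ^ 2)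
        + 2 / s * inner ℝ (g x) (z' - z)) := by
    refine mul_le_mul_of_nonneg_left ?_ (by positivity)
    linarith
  have h10 : s / (2 * L) * inner ℝ (g x) (u - x) ≤ s / (2 * L) * (f u - f x) :=
    mul_le_mul_of_nonneg_left (by linarith) (by positivity)
  have h11 : (s - 2) * s / (4 * L) * inner ℝ (g x) (y - x) ≤ (s - 2) * s / (4 * L) * (f y - f x) := by
    refine mul_le_mul_of_nonneg_left (by linarith) ?_
    have : 0 ≤ s - 2 := by linarith
    positivity
  -- the remaining identities use that the step size is `s / (2 L)` and the coupling weight `2 / s`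
  have h12 : s / (2 * L) * (inner ℝ (g x) (u - x) + (s - 2) / 2 * inner ℝ (g x) (y - x))
      = s / (2 * L) * inner ℝ (g x) (u - x) + (s - 2) * s / (4 * L) * inner ℝ (g x) (y - x) := by
    field_simp
    ring
  have h13 : s ^ 2 / (4 * L) * (f y' - f x) - s / (2 * L) * (f u - f x)
      - (s - 2) * s / (4 * L) * (f y - f x)
      = s ^ 2 / (4 * L) * (f y' - f u) - (s - 2) * s / (4 * L) * (f y - f u) := by
    field_simp
    ring
  have h14 : (k : ℝ) = s - 2 := by rw [hs]; ring
  rw [h14]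
  linarith

/-- Linear coupling summed over `t` iterations, against a minimizer `u`. -/
theorem agmFrom_potential (hP : Convex ℝ P) (hPc : IsCompact P) {L : ℝ} (hL : 0 < L)
    {f : Bundle n → ℝ} {g : Bundle n → Bundle n}
    (hlow : ∀ q ∈ P, ∀ u ∈ P, f q + inner ℝ (g q) (u - q) ≤ f u)
    (hup : ∀ q ∈ P, ∀ u ∈ P, f u ≤ f q + inner ℝ (g q) (u - q) + L / 2 * ‖u - q‖ ^ 2)
    {u : Bundle n} (hu : u ∈ P) (humin : IsMinOn f P u)
    (t k : ℕ) {y z : Bundle n} (hy : y ∈ P) (hz : z ∈ P) :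
    ((k + t : ℕ) : ℝ) * ((k + t : ℕ) + 2) / (4 * L) * (f ((agmFrom P L t k y z).run g) - f u)
      ≤ (k : ℝ) * (k + 2) / (4 * L) * (f y - f u) + 1 / 2 * ‖u - z‖ ^ 2 := by
  induction t generalizing k y z with
  | zero =>
    simp only [agmFrom, OracleAlg.run, add_zero]
    linarith [sq_nonneg ‖u - z‖]
  | succ t ih =>
    have hk : (0 : ℝ) ≤ k := Nat.cast_nonneg k
    obtain ⟨hy', hymin⟩ := gradStep_spec hPc ⟨y, hy⟩ L _
      (g ((2 / ((k : ℝ) + 2)) • z + (1 - 2 / ((k : ℝ) + 2)) • y))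
    obtain ⟨hz', hzmin⟩ := gradStep_spec hPc ⟨y, hy⟩ 1 z ((((k : ℝ) + 2) / (2 * L)) •
        g ((2 / ((k : ℝ) + 2)) • z + (1 - 2 / ((k : ℝ) + 2)) • y))
    have h1 := ih (k + 1) hy' hz'
    have h2 := agm_step hP hL hlow hup k hy hz hu rfl hy' hymin hz' hzmin
    -- `(k + 1) (k + 3) ≤ (k + 2) ^ 2`, where optimality of `u` supplies the sign
    have h3 := mul_le_mul_of_nonneg_right
      (show (k + 1 : ℝ) * (k + 1 + 2) / (4 * L) ≤ (k + 2 : ℝ) ^ 2 / (4 * L) by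
        gcongr; nlinarith) (sub_nonneg.2 (humin hy'))
    rw [show k + 1 + t = k + (t + 1) by omega] at h1
    push_cast at h1 h3 ⊢
    exact h1.trans (by linarith)

/-- The last iterate of AGM is nearly stationary: its Frank-Wolfe gap is `O(L r² / T)`. -/
theorem agm_gap_le (hP : Convex ℝ P) (hPc : IsCompact P) {L : ℝ} (hL : 0 < L)
    {f : Bundle n → ℝ} {g : Bundle n → Bundle n} (hf : ContinuousOn f P)
    (hlow : ∀ q ∈ P, ∀ u ∈ P, f q + inner ℝ (g q) (u - q) ≤ f u)
    (hup : ∀ q ∈ P, ∀ u ∈ P, f u ≤ f q + inner ℝ (g q) (u - q) + L / 2 * ‖u - q‖ ^ 2)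
    {r : ℝ} (h0 : (0 : Bundle n) ∈ P) (hr : ∀ q ∈ P, ‖q‖ ≤ r) {T : ℕ} (hT : 1 ≤ T)
    {u : Bundle n} (hu : u ∈ P) :
    inner ℝ (g ((agm P L T 0).run g)) ((agm P L T 0).run g - u) ≤ 4 * L * r ^ 2 / T := by
  obtain ⟨w, hw, hwmin⟩ := hPc.exists_isMinOn ⟨0, h0⟩ hf
  have hpot := agmFrom_potential hP hPc hL hlow hup hw hwmin T 0 h0 h0
  have hp := (agmFrom_feasible hP hPc L g T 0 h0 h0).2.2
  change _ ∈ P at hp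
  rw [agm]
  set p := (agmFrom P L T 0 0 0).run g
  have hT0 : (1 : ℝ) ≤ T := by exact_mod_cast hT
  have hT1 : (0 : ℝ) < T := by linarith
  have hr0 : 0 ≤ r := (norm_nonneg _).trans (hr _ h0)
  simp only [Nat.cast_zero, zero_mul, zero_div, zero_add, sub_zero] at hpot
  have hδ : (0 : ℝ) ≤ f p - f w := sub_nonneg.2 (hwmin hp)
  have hval : (T : ℝ) * (f p - f w) ≤ 2 * L * r ^ 2 / T := by
    have h1 : 1 / 2 * ‖w‖ ^ 2 ≤ 1 / 2 * r ^ 2 := by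
      have := hr w hw
      gcongr
    have h2 : (T : ℝ) * T / (4 * L) * (f p - f w) ≤ (T : ℝ) * (T + 2) / (4 * L) * (f p - f w) := by
      have : (T : ℝ) * T ≤ T * (T + 2) := by nlinarith
      gcongr
    have h3 : (T : ℝ) * (f p - f w)
        = (4 * L / T) * ((T : ℝ) * T / (4 * L) * (f p - f w)) := by field_simp
    calc (T : ℝ) * (f p - f w) = (4 * L / T) * ((T : ℝ) * T / (4 * L) * (f p - f w)) := h3
      _ ≤ (4 * L / T) * (1 / 2 * r ^ 2) :=
        mul_le_mul_of_nonneg_left (by linarith) (by positivity)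
      _ = 2 * L * r ^ 2 / T := by ring
  -- smoothness along the step of length `1 / T` from `p` towards `u`
  have hsP : p + (1 / (T : ℝ)) • (u - p) ∈ P :=
    hP.add_smul_sub_mem hp hu ⟨by positivity, by rw [div_le_one hT1]; exact hT0⟩
  have h1 := hup p hp _ hsP
  have h2 : f w ≤ _ := hwmin hsP
  rw [add_sub_cancel_left, inner_smul_right, norm_smul, Real.norm_of_nonneg (by positivity),
    mul_pow] at h1
  have h3 : ‖u - p‖ ^ 2 ≤ (2 * r) ^ 2 := by
    have := norm_sub_le u p
    have := hr u hu
    have := hr p hp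
    gcongr
    linarith
  have h4 : inner ℝ (g p) (p - u) = -inner ℝ (g p) (u - p) := by
    rw [← inner_neg_right, neg_sub]
  have h5 : 1 / (T : ℝ) * inner ℝ (g p) (p - u)
      ≤ (f p - f w) + L / 2 * ((1 / (T : ℝ)) ^ 2 * (2 * r) ^ 2) := by
    have : L / 2 * ((1 / (T : ℝ)) ^ 2 * ‖u - p‖ ^ 2) ≤ L / 2 * ((1 / (T : ℝ)) ^ 2 * (2 * r) ^ 2) := by
      gcongr
    rw [h4]
    linarith
  calc inner ℝ (g p) (p - u) = T * (1 / (T : ℝ) * inner ℝ (g p) (p - u)) := by field_simp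
    _ ≤ T * ((f p - f w) + L / 2 * ((1 / (T : ℝ)) ^ 2 * (2 * r) ^ 2)) := by gcongr
    _ = T * (f p - f w) + 2 * L * r ^ 2 / T := by field_simp
    _ ≤ 2 * L * r ^ 2 / T + 2 * L * r ^ 2 / T := by gcongr
    _ = 4 * L * r ^ 2 / T := by ring

end AGM

/-! ### Subgradients of the cost -/

/-- Separate the point `(y, f y)` from the open strict epigraph of `f` over the interior. -/
theorem ConvexOn.exists_subgradient_of_mem_interior {n : ℕ} {S : Set (Bundle n)}
    {f : Bundle n → ℝ} (hf : ConvexOn ℝ S f) (hc : ContinuousOn f S) {y : Bundle n}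
    (hy : y ∈ interior S) : ∃ g : Bundle n, ∀ z ∈ S, f y + inner ℝ g (z - y) ≤ f z := by
  have hopen : IsOpen {p : Bundle n × ℝ | p.1 ∈ interior S ∧ f p.1 < p.2} := by
    have hcont : ContinuousOn (fun p : Bundle n × ℝ => f p.1) (Prod.fst ⁻¹' interior S) :=
      (hc.mono interior_subset).comp continuousOn_fst fun p hp => hp
    have h := (hcont.sub continuousOn_snd).isOpen_inter_preimage
      (isOpen_interior.preimage continuous_fst) (isOpen_Iio (a := (0 : ℝ)))
    convert h using 1
    ext p
    simp
  have hconv : Convex ℝ {p : Bundle n × ℝ | p.1 ∈ interior S ∧ f p.1 < p.2} :=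
    (hf.subset interior_subset hf.1.interior).convex_strict_epigraph
  obtain ⟨l, hl⟩ := geometric_hahn_banach_open_point (x := (y, f y)) hconv hopen (by simp)
  have hsplit : ∀ z t, l (z, t) = l (z, 0) + t * l (0, 1) := by
    intro z t
    rw [← smul_eq_mul, ← map_smul, ← map_add]
    simp
  have hβ : l (0, 1) < 0 := by
    have := hl (y, f y + 1) ⟨hy, by simp⟩
    rw [hsplit, hsplit y (f y)] at this
    linarith
  set β := l (0, 1) with hβdef
  let g : Bundle n := (InnerProductSpace.toDual ℝ (Bundle n)).symm
    ((-β⁻¹) • l.comp (ContinuousLinearMap.inl ℝ (Bundle n) ℝ))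
  have hg : ∀ d, inner ℝ g d = -β⁻¹ * l (d, 0) := by
    intro d
    rw [← InnerProductSpace.toDual_apply_apply, LinearIsometryEquiv.apply_symm_apply]
    simp
  refine ⟨g, fun z hz => ?_⟩
  -- the midpoint of `y` and `z` is interior
  have hwint : (1 / 2 : ℝ) • y + (1 / 2 : ℝ) • z ∈ interior S :=
    hf.1.combo_interior_self_mem_interior hy hz (by norm_num) (by norm_num) (by norm_num)
  have hwle := hf.2 (interior_subset hy) hz (by norm_num : (0 : ℝ) ≤ 1 / 2)
    (by norm_num : (0 : ℝ) ≤ 1 / 2) (by norm_num)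
  set w := (1 / 2 : ℝ) • y + (1 / 2 : ℝ) • z with hw
  have hsub : f y + inner ℝ g (w - y) ≤ f w := by
    refine le_of_forall_pos_le_add fun η hη => ?_
    have h1 := hl (w, f w + η) ⟨hwint, by simpa using hη⟩
    rw [hsplit, hsplit y (f y)] at h1
    have h2 : l (w - y, 0) = l (w, 0) - l (y, 0) := by
      rw [← map_sub]; simp
    have h3 : l (w - y, 0) < -β * (f w + η - f y) := by linarith
    have h4 := mul_lt_mul_of_pos_left h3 (neg_pos.2 (inv_lt_zero.2 hβ))
    have h5 : -β⁻¹ * (-β * (f w + η - f y)) = f w + η - f y := by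
      field_simp [hβ.ne]
    rw [hg]
    linarith
  have hwy : w - y = (1 / 2 : ℝ) • (z - y) := by rw [hw]; module
  rw [hwy, inner_smul_right] at hsub
  simp only [smul_eq_mul] at hwle
  linarith

theorem exists_pos_add_smul_mem_of_mem_interior {n : ℕ} {S : Set (Bundle n)} {y : Bundle n}
    (hy : y ∈ interior S) (d : Bundle n) : ∃ s : ℝ, 0 < s ∧ y + s • d ∈ S := by
  have hcont : Filter.Tendsto (fun s : ℝ => y + s • d) (nhdsWithin 0 (Set.Ioi 0)) (nhds y) := by
    have : Continuous fun s : ℝ => y + s • d := by fun_prop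
    simpa using (this.tendsto 0).mono_left nhdsWithin_le_nhds
  obtain ⟨s, hs, hs0⟩ := ((hcont.eventually (mem_interior_iff_mem_nhds.1 hy)).and
    self_mem_nhdsWithin).exists
  exact ⟨s, hs0, hs⟩

/-- At an interior point, monotonicity makes subgradients nonnegative, and the Lipschitz bound
controls their norm. -/
theorem subgradient_mem_priceSet {n : ℕ} {S : Set (Bundle n)} {f : Bundle n → ℝ} {lam : ℝ}
    (hlam : 0 ≤ lam) (hmono : ∀ y ∈ S, ∀ z ∈ S, (∀ j, y j ≤ z j) → f y ≤ f z)
    (hlip : LipschitzOnWith lam.toNNReal f S) {y g : Bundle n} (hy : y ∈ interior S)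
    (hg : ∀ z ∈ S, f y + inner ℝ g (z - y) ≤ f z) : g ∈ priceSet n lam := by
  have hyS := interior_subset hy
  constructor
  · intro j
    obtain ⟨s, hs, hmem⟩ := exists_pos_add_smul_mem_of_mem_interior hy
      (-EuclideanSpace.single j (1 : ℝ))
    have h1 := hg _ hmem
    have h2 := hmono _ hmem _ hyS fun i => by
      by_cases h : i = j
      · subst h; simp [hs.le]
      · simp [h]
    rw [add_sub_cancel_left, inner_smul_right, inner_neg_right,
      EuclideanSpace.inner_single_right] at h1
    simp only [one_mul, RCLike.conj_to_real] at h1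
    have : 0 ≤ s * g j := by linarith
    exact nonneg_of_mul_nonneg_right this hs
  · obtain ⟨s, hs, hmem⟩ := exists_pos_add_smul_mem_of_mem_interior hy g
    have h1 := hg _ hmem
    have h2 := hlip.dist_le_mul _ hmem _ hyS
    rw [Real.dist_eq, dist_eq_norm, add_sub_cancel_left, norm_smul, Real.norm_of_nonneg hs.le,
      Real.coe_toNNReal _ hlam] at h2
    rw [add_sub_cancel_left, inner_smul_right, real_inner_self_eq_norm_sq] at h1
    have h3 : s * ‖g‖ ^ 2 ≤ lam * (s * ‖g‖) := by linarith [le_abs_self (f (y + s • g) - f y)]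
    by_contra! hlt
    have hgpos : 0 < ‖g‖ := hlam.trans_lt hlt
    nlinarith [mul_pos (mul_pos hs hgpos) (sub_pos.2 hlt)]

/-- At boundary points a subgradient up to an arbitrarily small error is enough; it is an exact
subgradient at a nearby interior point. -/
theorem ConvexOn.exists_approx_subgradient_mem_priceSet {n : ℕ} {S : Set (Bundle n)}
    {f : Bundle n → ℝ} {lam : ℝ} (hlam : 0 < lam) (hf : ConvexOn ℝ S f)
    (hne : (interior S).Nonempty)
    (hmono : ∀ y ∈ S, ∀ z ∈ S, (∀ j, y j ≤ z j) → f y ≤ f z)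
    (hlip : LipschitzOnWith lam.toNNReal f S) {y : Bundle n} (hy : y ∈ S) {η : ℝ} (hη : 0 < η) :
    ∃ g ∈ priceSet n lam, ∀ z ∈ S, f y - f z ≤ inner ℝ g (y - z) + η := by
  have hcl : y ∈ closure (interior S) := by
    rw [hf.1.closure_interior_eq_closure_of_nonempty_interior hne]
    exact subset_closure hy
  obtain ⟨w, hw, hdist⟩ := Metric.mem_closure_iff.1 hcl (η / (2 * lam)) (by positivity)
  have hwS := interior_subset hw
  obtain ⟨g, hg⟩ := hf.exists_subgradient_of_mem_interior hlip.continuousOn hw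
  have hgP := subgradient_mem_priceSet hlam.le hmono hlip hw hg
  refine ⟨g, hgP, fun z hz => ?_⟩
  have h1 := hg z hz
  have h2 := hlip.dist_le_mul _ hy _ hwS
  rw [Real.dist_eq, Real.coe_toNNReal _ hlam.le] at h2
  have h3 : inner ℝ g (w - y) ≤ lam * dist y w := by
    rw [dist_comm, dist_eq_norm]
    exact (real_inner_le_norm _ _).trans (by gcongr; exact hgP.2)
  have h4 : lam * dist y w ≤ η / 2 := by
    calc lam * dist y w ≤ lam * (η / (2 * lam)) := by gcongr
      _ = η / 2 := by field_simp
  have h5 : inner ℝ g (z - w) = -inner ℝ g (y - z) - inner ℝ g (w - y) := by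
    rw [← inner_neg_right, ← inner_sub_right]; congr 1; abel
  linarith [le_abs_self (f y - f w)]

/-! ### The price set -/

theorem convex_priceSet (n : ℕ) (lam : ℝ) : Convex ℝ (priceSet n lam) := by
  intro x hx y hy a b ha hb hab
  refine ⟨fun j => ?_, ?_⟩
  · have := hx.1 j
    have := hy.1 j
    simp only [PiLp.add_apply, PiLp.smul_apply, smul_eq_mul]
    positivity
  · simpa using convex_closedBall (0 : Bundle n) lam (by simpa using hx.2) (by simpa using hy.2)
      ha hb hab

theorem isCompact_priceSet (n : ℕ) (lam : ℝ) : IsCompact (priceSet n lam) := by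
  refine (isCompact_closedBall (0 : Bundle n) lam).of_isClosed_subset ?_ fun p hp => by
    simpa using hp.2
  have h1 : IsClosed {p : Bundle n | ∀ j, 0 ≤ p j} := by
    simp only [Set.ofPred_forall]
    exact isClosed_iInter fun j => isClosed_le (by fun_prop) (by fun_prop)
  exact h1.inter (isClosed_le continuous_norm continuous_const)

theorem zero_mem_priceSet (n : ℕ) {lam : ℝ} (hlam : 0 ≤ lam) : (0 : Bundle n) ∈ priceSet n lam :=
  ⟨fun _ => le_rfl, by simpa using hlam⟩

/-! ### The market -/

theorem sum_mem_natCast_smul {n m : ℕ} {C : Set (Bundle n)} (hC : Convex ℝ C) (hm : 1 ≤ m)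
    {z : Fin m → Bundle n} (hz : ∀ i, z i ∈ C) : ∑ i, z i ∈ (m : ℝ) • C := by
  have hm0 : (m : ℝ) ≠ 0 := by positivity
  refine ⟨∑ i, (m : ℝ)⁻¹ • z i, hC.sum_mem (fun _ _ => by positivity) ?_ fun i _ => hz i, ?_⟩
  · simp [hm0]
  · simp [← Finset.smul_sum, smul_smul, hm0]

theorem smoothedCost_strongConvexOn {n : ℕ} {S : Set (Bundle n)} {c : Bundle n → ℝ}
    (hc : ConvexOn ℝ S c) (μ : ℝ) : StrongConvexOn S μ (smoothedCost μ c) := by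
  rw [strongConvexOn_iff_convex]
  simpa [smoothedCost] using hc

theorem smoothedCost_continuousOn {n : ℕ} {S : Set (Bundle n)} {c : Bundle n → ℝ}
    (hc : ContinuousOn c S) (μ : ℝ) : ContinuousOn (smoothedCost μ c) S :=
  hc.add (by fun_prop)

theorem IsDemand.isMinOn {n : ℕ} {C : Set (Bundle n)} {v : Bundle n → ℝ} {p x : Bundle n}
    (h : IsDemand C v p x) : IsMinOn (fun z => (-v) z - inner ℝ (-p) z) C x := by
  intro z hz
  have : v z - inner ℝ z p ≤ v x - inner ℝ x p := h.2 hz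
  simp only [Set.mem_ofPred_eq, Pi.neg_apply, inner_neg_left, real_inner_comm _ p] at this ⊢
  linarith

namespace IsOfflineMarket

variable {n m : ℕ} {α lam : ℝ} {C : Set (Bundle n)} {v : Fin m → Bundle n → ℝ}
  {c : Bundle n → ℝ}

theorem isCompact_smul (h : IsOfflineMarket α lam C v c) : IsCompact ((m : ℝ) • C) :=
  h.isCompact.smul (m : ℝ)

theorem nonempty_smul (h : IsOfflineMarket α lam C v c) : ((m : ℝ) • C).Nonempty :=
  (h.interior_nonempty.mono interior_subset).smul_set

theorem supply_spec (h : IsOfflineMarket α lam C v c) (μ : ℝ) (p : Bundle n) :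
    supply m C (smoothedCost μ c) p ∈ (m : ℝ) • C ∧
      IsMinOn (fun y => smoothedCost μ c y - inner ℝ p y) ((m : ℝ) • C)
        (supply m C (smoothedCost μ c) p) := by
  have hcont := smoothedCost_continuousOn h.cost_lipschitzOnWith.continuousOn μ
  have := argminOn_spec (f := fun y => smoothedCost μ c y - inner ℝ y p) h.isCompact_smul
    h.nonempty_smul (hcont.sub (by fun_prop))
  simp only [real_inner_comm _ p]
  exact this

theorem dualObjective_eq (f : Bundle n → ℝ) (p : Bundle n) :
    dualObjective C v f p
      = convexConj ((m : ℝ) • C) f p + ∑ i, convexConj C (-v i) (-p) := by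
  simp [dualObjective, concaveConj_eq_neg_convexConj]

theorem dualObjective_add_inner_le (h : IsOfflineMarket α lam C v c) (μ : ℝ) {p : Bundle n}
    {x : Fin m → Bundle n} (hx : ∀ i, IsDemand C (v i) p (x i)) (u : Bundle n) :
    dualObjective C v (smoothedCost μ c) p
        + inner ℝ (supply m C (smoothedCost μ c) p - ∑ i, x i) (u - p)
      ≤ dualObjective C v (smoothedCost μ c) u := by
  obtain ⟨hs, hsmin⟩ := h.supply_spec μ p
  have h1 := convexConj_add_inner_le h.isCompact_smul
    (smoothedCost_continuousOn h.cost_lipschitzOnWith.continuousOn μ) hs hsmin u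
  have h2 : ∀ i ∈ Finset.univ, convexConj C (-v i) (-p) + inner ℝ (x i) (-u - -p)
      ≤ convexConj C (-v i) (-u) := fun i _ =>
    convexConj_add_inner_le h.isCompact (h.val_continuousOn i).neg (hx i).1 (hx i).isMinOn (-u)
  have h3 := Finset.sum_le_sum h2
  rw [Finset.sum_add_distrib, ← sum_inner, neg_sub_neg, ← neg_sub u p, inner_neg_right] at h3
  rw [dualObjective_eq, dualObjective_eq, inner_sub_left]
  linarith

theorem dualObjective_le_add_inner_add (h : IsOfflineMarket α lam C v c) (hα : 0 < α) {μ : ℝ}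
    (hμ : 0 < μ) {p : Bundle n} {x : Fin m → Bundle n} (hx : ∀ i, IsDemand C (v i) p (x i))
    (u : Bundle n) :
    dualObjective C v (smoothedCost μ c) u
      ≤ dualObjective C v (smoothedCost μ c) p
        + inner ℝ (supply m C (smoothedCost μ c) p - ∑ i, x i) (u - p)
        + (1 / μ + m / α) / 2 * ‖u - p‖ ^ 2 := by
  obtain ⟨hs, hsmin⟩ := h.supply_spec μ p
  have h1 := convexConj_le_add_inner_add hμ (smoothedCost_strongConvexOn h.cost_convexOn μ)
    hs hsmin u
  have h2 : ∀ i ∈ Finset.univ, convexConj C (-v i) (-u)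
      ≤ convexConj C (-v i) (-p) + inner ℝ (x i) (-u - -p) + 1 / α / 2 * ‖-u - -p‖ ^ 2 :=
    fun i _ => convexConj_le_add_inner_add hα (UniformConcaveOn.neg (h.val_strongConcaveOn i))
      (hx i).1 (hx i).isMinOn (-u)
  have h3 := Finset.sum_le_sum h2
  rw [Finset.sum_add_distrib, Finset.sum_add_distrib, ← sum_inner, neg_sub_neg, ← neg_sub u p,
    inner_neg_right, norm_neg, Finset.sum_const, Finset.card_univ, Fintype.card_fin,
    nsmul_eq_mul] at h3
  rw [dualObjective_eq, dualObjective_eq, inner_sub_left]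
  have h4 : (1 / μ + m / α) / 2 * ‖u - p‖ ^ 2
      = 1 / μ / 2 * ‖u - p‖ ^ 2 + m * (1 / α / 2 * ‖u - p‖ ^ 2) := by ring
  linarith

theorem exists_isGreatest_socialWelfare (h : IsOfflineMarket α lam C v c) (hm : 1 ≤ m) :
    ∃ w, IsGreatest (socialWelfare v c '' {z | ∀ i, z i ∈ C}) w := by
  have hK : IsCompact {z : Fin m → Bundle n | ∀ i, z i ∈ C} := isCompact_pi_infinite fun _ =>
    h.isCompact
  obtain ⟨x, hx⟩ := h.interior_nonempty.mono interior_subset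
  refine (hK.image_of_continuousOn ?_).exists_isGreatest ⟨_, fun _ => x, fun _ => hx, rfl⟩
  unfold socialWelfare
  refine ContinuousOn.sub (continuousOn_finsetSum _ fun i _ => ?_) ?_
  · exact (h.val_continuousOn i).comp (by fun_prop) fun z hz => hz i
  · exact h.cost_lipschitzOnWith.continuousOn.comp (by fun_prop) fun z hz =>
      sum_mem_natCast_smul h.convex hm hz

/-- If the excess supply at the prices `p` satisfies the first-order optimality condition on the
price set up to `B`, then the demanded bundles lose at most `B`, plus the smoothing bias, in
welfare: by weak duality the loss is bounded by a Bregman-type remainder of the cost between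
aggregate demand and supply, and an approximate subgradient of the cost at the aggregate demand is a
feasible price vector against which to test the optimality condition. -/
theorem socialWelfare_sub_le (h : IsOfflineMarket α lam C v c) (hlam : 0 < lam) (hm : 1 ≤ m)
    {μ : ℝ} (hμ : 0 ≤ μ) {p : Bundle n} {x : Fin m → Bundle n}
    (hx : ∀ i, IsDemand C (v i) p (x i)) {B : ℝ}
    (hB : ∀ u ∈ priceSet n lam,
      inner ℝ (supply m C (smoothedCost μ c) p - ∑ i, x i) (p - u) ≤ B)
    {z : Fin m → Bundle n} (hz : ∀ i, z i ∈ C) :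
    socialWelfare v c z - socialWelfare v c x ≤ μ / 2 * (m * Metric.diam C) ^ 2 + B := by
  have hm0 : (0 : ℝ) < m := by positivity
  have hint : (interior ((m : ℝ) • C)).Nonempty := by
    rw [interior_smul₀ hm0.ne']
    exact h.interior_nonempty.smul_set
  obtain ⟨hs, hsmin⟩ := h.supply_spec μ p
  have hX := sum_mem_natCast_smul h.convex hm fun i => (hx i).1
  have hZ := sum_mem_natCast_smul h.convex hm hz
  have h1 := Finset.sum_le_sum fun i (_ : i ∈ Finset.univ) =>
    (show v i (z i) - inner ℝ (z i) p ≤ v i (x i) - inner ℝ (x i) p from (hx i).2 (hz i))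
  rw [Finset.sum_sub_distrib, Finset.sum_sub_distrib, ← sum_inner, ← sum_inner] at h1
  have h2 : smoothedCost μ c _ - _ ≤ smoothedCost μ c _ - _ := hsmin hZ
  have hnorm : ‖∑ i, z i‖ ≤ m * Metric.diam C := by
    calc ‖∑ i, z i‖ ≤ ∑ _i : Fin m, Metric.diam C :=
          norm_sum_le_of_le _ fun i _ => h.norm_le_diam _ (hz i)
      _ = m * Metric.diam C := by simp
  have h3 : μ / 2 * ‖∑ i, z i‖ ^ 2 ≤ μ / 2 * (m * Metric.diam C) ^ 2 := by gcongr
  refine le_of_forall_pos_le_add fun η hη => ?_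
  obtain ⟨u, hu, hsub⟩ := h.cost_convexOn.exists_approx_subgradient_mem_priceSet hlam hint
    h.cost_mono h.cost_lipschitzOnWith hX hη
  have h4 := hsub _ hs
  have h5 := hB u hu
  set y := supply m C (smoothedCost μ c) p
  set X := ∑ i, x i with hXdef
  set Z := ∑ i, z i with hZdef
  simp only [smoothedCost] at h2
  have h6 : 0 ≤ μ / 2 * ‖y‖ ^ 2 := by positivity
  simp only [inner_sub_left, inner_sub_right, real_inner_comm _ p, real_inner_comm _ u]
    at h1 h2 h4 h5
  simp only [socialWelfare, ← hXdef, ← hZdef]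
  linarith

end IsOfflineMarket

/-! ### The query bound -/

/-- Smoothing bias plus stationarity error, for the prescribed `μ` and with `s = √T`; the true
constants are `3` and `4`. -/
theorem welfare_error_le {lam D α m μ s : ℝ} (hlam : 0 < lam) (hD : 0 < D) (hα : 0 < α)
    (hm : 0 < m) (hs : 0 < s) (hμ : μ = 2 * lam / (m * D * s)) :
    μ / 2 * (m * D) ^ 2 + 4 * (1 / μ + m / α) * lam ^ 2 / s ^ 2
      ≤ 9 * lam * m * D / s + 16 * lam ^ 2 * m / (α * s ^ 2) := by
  have h1 : μ / 2 * (m * D) ^ 2 + 4 * (1 / μ + m / α) * lam ^ 2 / s ^ 2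
      = 3 * (lam * m * D / s) + 4 * (lam ^ 2 * m / (α * s ^ 2)) := by
    rw [hμ]
    field_simp
    ring
  have h2 : 0 ≤ lam * m * D / s := by positivity
  have h3 : 0 ≤ lam ^ 2 * m / (α * s ^ 2) := by positivity
  have h4 : 9 * lam * m * D / s + 16 * lam ^ 2 * m / (α * s ^ 2)
      = 9 * (lam * m * D / s) + 16 * (lam ^ 2 * m / (α * s ^ 2)) := by ring
  linarith

theorem welfare_error_le_of_query_count {lam D α m s ε : ℝ} (hlam : 0 < lam) (hD : 0 < D)
    (hα : 0 < α) (hm : 0 < m) (hs : 1 ≤ s) (hε : 0 < ε)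
    (h : (9 * lam * D + 16 * lam ^ 2 / α) ^ 2 * m ^ 2 / ε ^ 2 ≤ s ^ 2) :
    9 * lam * m * D / s + 16 * lam ^ 2 * m / (α * s ^ 2) ≤ ε := by
  have hs0 : 0 < s := by linarith
  rw [← mul_pow, ← div_pow] at h
  have h1 := (sq_le_sq₀ (by positivity) hs0.le).1 h
  rw [div_le_iff₀ hε] at h1
  -- `s = √T ≥ 1`, so the `1 / T` term is dominated by a `1 / √T` term
  have h2 : 16 * lam ^ 2 * m / (α * s ^ 2) ≤ 16 * lam ^ 2 * m / (α * s) := by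
    gcongr
    nlinarith
  calc _ ≤ 9 * lam * m * D / s + 16 * lam ^ 2 * m / (α * s) := by gcongr
    _ = (9 * lam * D + 16 * lam ^ 2 / α) * m / s := by field_simp
    _ ≤ ε := by rw [div_le_iff₀ hs0]; linarith

theorem mainTheorem1 (α lam D : ℝ) (hα : 0 < α) (hlam : 0 < lam) (hD : 0 < D) :
    ∃ K : ℝ, 0 < K ∧
      ∀ (n m : ℕ) (C : Set (Bundle n)) (v : Fin m → Bundle n → ℝ) (c : Bundle n → ℝ),
        1 ≤ m → IsOfflineMarket α lam C v c → Metric.diam C = D →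
        -- `x i p` is the bundle demanded by consumer `i` at prices `p`
        ∀ x : Fin m → Bundle n → Bundle n,
          (∀ i, ∀ p : Bundle n, (∀ j, 0 ≤ p j) → IsDemand C (v i) p (x i p)) →
          ∃ maxSW : ℝ,
            IsGreatest (socialWelfare v c '' {z | ∀ i, z i ∈ C}) maxSW ∧
            ∀ T : ℕ, 1 ≤ T →
              let aggregateDemand : Bundle n → Bundle n := fun p => ∑ i, x i p
              let alg := offlineSWAlg m α lam C c T
              let cμ := smoothedCost (smoothingParam m lam C T) c
              let pT : Bundle n := alg.run aggregateDemand
              -- exactly `T` queries, all of them and the output feasible prices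
              (alg.queries aggregateDemand).length = T ∧
              (∀ q ∈ alg.queries aggregateDemand, q ∈ priceSet n lam) ∧
              pT ∈ priceSet n lam ∧
              -- the excess supply, which drives AGM, is the gradient of the smoothed dual
              (∀ p ∈ priceSet n lam,
                HasGradientAt (dualObjective C v cμ)
                  (supply m C cμ p - aggregateDemand p) p) ∧
              -- the welfare guarantee
              |maxSW - socialWelfare v c (fun i => x i pT)| ≤
                9 * lam * m * D / √(T : ℝ) + 16 * lam ^ 2 * m / (α * T) ∧
              -- `O(m² / ε²)` queries suffice for error `ε`
              ∀ ε : ℝ, 0 < ε → K * (m : ℝ) ^ 2 / ε ^ 2 ≤ T →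
                |maxSW - socialWelfare v c (fun i => x i pT)| ≤ ε := by
  refine ⟨(9 * lam * D + 16 * lam ^ 2 / α) ^ 2, by positivity, ?_⟩
  intro n m C v c hm h hdiam x hx
  obtain ⟨maxSW, hmax⟩ := h.exists_isGreatest_socialWelfare hm
  refine ⟨maxSW, hmax, fun T hT => ?_⟩
  intro aggregateDemand alg cμ pT
  have hm0 : (0 : ℝ) < m := by positivity
  have hT1 : (1 : ℝ) ≤ T := by exact_mod_cast hT
  have hs1 : 1 ≤ √(T : ℝ) := Real.one_le_sqrt.2 hT1
  have hsq : √(T : ℝ) ^ 2 = T := Real.sq_sqrt (by positivity)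
  have hμ : smoothingParam m lam C T = 2 * lam / (m * D * √(T : ℝ)) := by
    rw [smoothingParam, hdiam]
  have hμ0 : 0 < smoothingParam m lam C T := by rw [hμ]; positivity
  set μ := smoothingParam m lam C T with hμdef
  have hL : 0 < 1 / μ + m / α := by positivity
  have hconv := convex_priceSet n lam
  have hcomp := isCompact_priceSet n lam
  have h0 := zero_mem_priceSet n hlam.le
  let g : Bundle n → Bundle n := fun p => supply m C cμ p - aggregateDemand p
  have hlow : ∀ q ∈ priceSet n lam, ∀ u,
      dualObjective C v cμ q + inner ℝ (g q) (u - q) ≤ dualObjective C v cμ u := fun q hq u =>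
    h.dualObjective_add_inner_le μ (fun i => hx i q hq.1) u
  have hup : ∀ q ∈ priceSet n lam, ∀ u, dualObjective C v cμ u
      ≤ dualObjective C v cμ q + inner ℝ (g q) (u - q) + (1 / μ + m / α) / 2 * ‖u - q‖ ^ 2 :=
    fun q hq u => h.dualObjective_le_add_inner_add hα hμ0 (fun i => hx i q hq.1) u
  have hgrad : ∀ p ∈ priceSet n lam, HasGradientAt (dualObjective C v cμ) (g p) p := fun p hp =>
    hasGradientAt_of_quadratic_bounds (hlow p hp) (hup p hp)
  have hrun : pT = (agm (priceSet n lam) (1 / μ + m / α) T 0).run g :=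
    OracleAlg.run_mapAnswers _ _ _
  have hqueries : alg.queries aggregateDemand
      = (agm (priceSet n lam) (1 / μ + m / α) T 0).queries g :=
    OracleAlg.queries_mapAnswers _ _ _
  obtain ⟨hlen, hmem, hout⟩ := agmFrom_feasible hconv hcomp (1 / μ + m / α) g T 0 h0 h0
  have hpT : pT ∈ priceSet n lam := hrun ▸ hout
  have herr : |maxSW - socialWelfare v c (fun i => x i pT)| ≤
      9 * lam * m * D / √(T : ℝ) + 16 * lam ^ 2 * m / (α * T) := by
    obtain ⟨z, hz, rfl⟩ := hmax.1
    have hxC : socialWelfare v c (fun i => x i pT) ≤ socialWelfare v c z :=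
      hmax.2 ⟨_, fun i => (hx i pT hpT.1).1, rfl⟩
    rw [abs_of_nonneg (sub_nonneg.2 hxC)]
    have hgap : ∀ u ∈ priceSet n lam,
        inner ℝ (g pT) (pT - u) ≤ 4 * (1 / μ + m / α) * lam ^ 2 / T := by
      intro u hu
      rw [hrun]
      exact agm_gap_le hconv hcomp hL
        (fun p hp => (hgrad p hp).continuousAt.continuousWithinAt)
        (fun q hq u _ => hlow q hq u) (fun q hq u _ => hup q hq u) h0 (fun q hq => hq.2) hT hu
    have hloss := h.socialWelfare_sub_le hlam hm hμ0.le (fun i => hx i pT hpT.1) hgap hz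
    rw [hdiam] at hloss
    have hnum := welfare_error_le hlam hD hα hm0 (by positivity : 0 < √(T : ℝ)) hμ
    rw [hsq] at hnum
    exact hloss.trans hnum
  refine ⟨hqueries ▸ hlen, hqueries ▸ hmem, hpT, hgrad, herr, fun ε hε hK => herr.trans ?_⟩
  have hfin := welfare_error_le_of_query_count hlam hD hα hm0 hs1 hε (hK.trans_eq hsq.symm)
  rwa [hsq] at hfin
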